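/- Let $a,b,c\in\mathbb R$ with ($c=0$ and $a\ne b$) or ($c>0$ and $a<b$), put $Q(x)=ax(x-1)+bx+c$, let $J_\nu$ be the Bessel function of the first kind of order $\nu$ and $$N_\nu(z)=az^2J_\nu''(z)+bzJ_\nu'(z)+cJ_\nu(z).$$ Let $\nu\ge 0$ be real, not smaller than any real root of $Q$ (that is, $\nu\ge\max\{0,\nu_0\}$ with $\nu_0$ the largest real root of $Q$, if there is one), and such that $Q(\nu)\ne0$. Consider the normalized functions $$f_\nu(z)=\Big[\tfrac{2^\nu\Gamma(\nu+1)}{Q(\nu)}N_\nu(z)\Big]^{1/\nu}\ (\nu\neq0),\qquad g_\nu(z)=\tfrac{2^\nu\Gamma(\nu+1)}{Q(\nu)}z^{1-\nu}N_\nu(z),\qquad h_\nu(z)=\tfrac{2^\nu\Gamma(\nu+1)}{Q(\nu)}z^{1-\nu/2}N_\nu(\sqrt z)$$ on the unit disk $\mathbb D$, with the branches that are holomorphic in $\mathbb D$ and have derivative $1$ at $0$. Let $\lambda_{\nu,1}$ be the smallest positive zero of $N_\nu$, and suppose that $1<\lambda_{\nu,1}$. Let $\varphi$ be a Ma–Minda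 function: holomorphic and univalent in $\mathbb D$, with $\operatorname{Re}\varphi>0$, $\varphi(0)=1$, $\varphi'(0)>0$, and $\varphi(\mathbb D)$ starlike with respect to $1$ and symmetric about the real axis. Let $\mathcal S^*(\varphi)$ be the class of holomorphic $f$ on $\mathbb D$ with $f(0)=0$, $f'(0)=1$ and $zf'(z)/f(z)\prec\varphi(z)$ (subordination in $\mathbb D$). Let $\beta$ be the radius of the largest disk $\{w:|w-1|<\beta\}$ contained in $\varphi(\mathbb D)$, and assume $\varphi(-1)=1-\beta$, where $\varphi(-1)$ is the radial limit $\lim_{t\to-1^+}\varphi(t)$. Then: 1. if $\nu\ne0$ and $1-\dfrac{N_\nu'(1)}{\nu N_\nu(1)}<\beta$, then $f_\nu$ is well defined on $\mathbb D$ and belongs to $\mathcal S^*(\varphi)$; 2. if $\nu-\dfrac{N_\nu'(1)}{N_\nu(1)}<\beta$, then $g_\nu$ belongs to $\mathcal S^*(\varphi)$; 3. if $\dfrac{\nu}{2}-\dfrac{N_\nu'(1)}{2N_\nu(1)}<\beta$, then $h_\nu$ belongs to $\mathcal S^*(\varphi)$. -/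

import Mathlib

open Set Filter Topology

/-- The Bessel function of the first kind of real order `ν`, with the principal branch of the
powers `(z / 2) ^ (2 n + ν)`; it is holomorphic on the plane slit along `(-∞, 0]`. -/
noncomputable def besselJ (ν : ℝ) (z : ℂ) : ℂ :=
  ∑' n : ℕ, (-1 : ℂ) ^ n / ((n.factorial : ℂ) * Complex.Gamma ((n : ℂ) + (ν : ℂ) + 1)) *
    (z / 2) ^ (2 * (n : ℂ) + (ν : ℂ))

/-- `N_ν(z) = a z² J_ν''(z) + b z J_ν'(z) + c J_ν(z)`, meant for `z` in the slit plane. -/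
noncomputable def besselN (a b c ν : ℝ) (z : ℂ) : ℂ :=
  (a : ℂ) * z ^ 2 * deriv (deriv (besselJ ν)) z + (b : ℂ) * z * deriv (besselJ ν) z +
    (c : ℂ) * besselJ ν z

/-- `Q(x) = a x (x - 1) + b x + c`. -/
def quadQ (a b c x : ℝ) : ℝ := a * x * (x - 1) + b * x + c

/-- The normalizing constant `2 ^ ν Γ(ν + 1) / Q(ν)`. -/
noncomputable def normConst (a b c ν : ℝ) : ℝ :=
  2 ^ ν * Real.Gamma (ν + 1) / quadQ a b c ν

/-- `F` is (on the unit disk) the function `f_ν = [2^ν Γ(ν+1) N_ν(z) / Q(ν)] ^ (1/ν)`, with the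
branch of the power normalized by `f_ν'(0) = 1`: if `2^ν Γ(ν+1) N_ν(z) / Q(ν) = z^ν e^{L(z)}` with
`L` holomorphic in the disk and `L(0) = 0`, then `f_ν(z) = z e^{L(z)/ν}`. As `L` is unique on the
disk, so is `F`. -/
def IsNormalizedF (a b c ν : ℝ) (F : ℂ → ℂ) : Prop :=
  ∃ L : ℂ → ℂ, DifferentiableOn ℂ L (Metric.ball 0 1) ∧ L 0 = 0 ∧
    (∀ z ∈ Metric.ball (0 : ℂ) 1 ∩ Complex.slitPlane,
      (normConst a b c ν : ℂ) * besselN a b c ν z = z ^ (ν : ℂ) * Complex.exp (L z)) ∧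
    ∀ z ∈ Metric.ball (0 : ℂ) 1, F z = z * Complex.exp (L z / (ν : ℂ))

/-- `g_ν(z) = 2^ν Γ(ν+1) z^(1-ν) N_ν(z) / Q(ν)`, given by this formula on the slit plane and
extended by limits to `(-∞, 0]`. -/
noncomputable def normalizedG (a b c ν : ℝ) : ℂ → ℂ :=
  extendFrom Complex.slitPlane fun z =>
    (normConst a b c ν : ℂ) * z ^ (1 - (ν : ℂ)) * besselN a b c ν z

/-- `h_ν(z) = 2^ν Γ(ν+1) z^(1-ν/2) N_ν(√z) / Q(ν)`, given by this formula on the slit plane and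
extended by limits to `(-∞, 0]`. -/
noncomputable def normalizedH (a b c ν : ℝ) : ℂ → ℂ :=
  extendFrom Complex.slitPlane fun z =>
    (normConst a b c ν : ℂ) * z ^ (1 - (ν : ℂ) / 2) * besselN a b c ν (z ^ (1 / 2 : ℂ))

/-- The class `𝒜`: holomorphic in the unit disk with `f(0) = 0` and `f'(0) = 1`. -/
def IsClassA (f : ℂ → ℂ) : Prop :=
  DifferentiableOn ℂ f (Metric.ball 0 1) ∧ f 0 = 0 ∧ deriv f 0 = 1

/-- Ma–Minda functions on the unit disk. -/
structure IsMaMinda (φ : ℂ → ℂ) : Prop where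
  holomorphic : DifferentiableOn ℂ φ (Metric.ball 0 1)
  univalent : InjOn φ (Metric.ball 0 1)
  re_pos : ∀ z ∈ Metric.ball (0 : ℂ) 1, 0 < (φ z).re
  map_zero : φ 0 = 1
  deriv_zero_im : (deriv φ 0).im = 0
  deriv_zero_pos : 0 < (deriv φ 0).re
  starlike : StarConvex ℝ (1 : ℂ) (φ '' Metric.ball 0 1)
  symmetric : ∀ w ∈ φ '' Metric.ball 0 1, (starRingEnd ℂ) w ∈ φ '' Metric.ball 0 1

/-- Subordination `F ≺ G` in the unit disk. -/
def Subordinate (F G : ℂ → ℂ) : Prop :=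
  DifferentiableOn ℂ F (Metric.ball 0 1) ∧
    ∃ ω : ℂ → ℂ, DifferentiableOn ℂ ω (Metric.ball 0 1) ∧
      MapsTo ω (Metric.ball 0 1) (Metric.ball 0 1) ∧ ω 0 = 0 ∧
      ∀ z ∈ Metric.ball (0 : ℂ) 1, F z = G (ω z)

open Classical in
/-- `z f'(z) / f(z)`, with its limit `1` at the origin (for `f` in the class `𝒜`). -/
noncomputable def starQuotient (f : ℂ → ℂ) (z : ℂ) : ℂ :=
  if z = 0 then 1 else z * deriv f z / f z

/-- The class `𝒮*(φ)`: `f ∈ 𝒜` without zeros in the punctured disk such that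
`z f'(z) / f(z) ≺ φ(z)`. -/
def IsMaMindaStarlike (φ f : ℂ → ℂ) : Prop :=
  IsClassA f ∧ (∀ z ∈ Metric.ball (0 : ℂ) 1, z ≠ 0 → f z ≠ 0) ∧
    Subordinate (starQuotient f) φ

/-!
The normalized `N_ν` equals `z ^ ν * W (z ^ 2)` for an entire function `W` with `W 0 = 1`, so that
`g_ν z = z * W (z ^ 2)`, `h_ν z = z * W z` and `f_ν z = z * W (z ^ 2) ^ (1 / ν)`.

`W` is a locally uniform limit of polynomials having only positive zeros. The Bessel series is such
a limit of Jacobi polynomials, obtained from `1` by operators `p ↦ p + B w p' - A w p` with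
`A, B ≥ 0`, and passing from `J_ν` to `N_ν` amounts to further operators of this kind. All of them
preserve positivity of the zeros: where `p ≠ 0`, a zero of the image satisfies
`1 / w + B p' / p = A`, and `p' / p = ∑ 1 / (w - r)` over positive `r` excludes this off the
positive axis.

If a polynomial has positive zeros `r` only, all larger than `R`, then `|w| ≤ R` gives
`|1 / (w - r)| ≤ 1 / (r - R)`; summing, `|p' / p|` at `w` is at most `-p' / p` at `R`. In the limit
`|W' / W| ≤ -W'(1) / W(1)` on the unit disk, since `W` has no zeros on `[0, 1]`. For
`f = f_ν, g_ν, h_ν` this bounds `|z f' / f - 1|` by the left-hand side of the respective hypothesis,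
hence by a constant less than `β`. So `z f' / f` maps the disk into `φ(𝔻)`, and composing it with
the holomorphic inverse of `φ` gives the subordination.
-/

section PositiveRoots

open Polynomial

lemma logDeriv_eval_eq_sum_roots {p : ℂ[X]} {w : ℂ} (hw : p.eval w ≠ 0) :
    logDeriv (fun z => p.eval z) w = (p.roots.map fun r => 1 / (w - r)).sum := by
  rw [logDeriv_apply, Polynomial.deriv,
    (IsAlgClosed.splits p).eval_derivative_div_eval_of_ne_zero hw]

/-- Complex polynomials with value `1` at the origin all of whose zeros are positive reals. -/
def PosRooted (p : ℂ[X]) : Prop :=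
  p.eval 0 = 1 ∧ ∀ w, p.eval w = 0 → ∃ r : ℝ, 0 < r ∧ w = r

/-- The operator `p ↦ p + B X p' - A X p`, which preserves `PosRooted` for `A, B ≥ 0`. -/
noncomputable def eulerOp (A B : ℝ) (p : ℂ[X]) : ℂ[X] :=
  p + C (B : ℂ) * X * derivative p - C (A : ℂ) * X * p

lemma eval_eulerOp (A B : ℝ) (p : ℂ[X]) (w : ℂ) :
    (eulerOp A B p).eval w = p.eval w + B * w * p.derivative.eval w - A * w * p.eval w := by
  simp [eulerOp]

namespace PosRooted

variable {p : ℂ[X]} {w : ℂ}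

lemma exists_pos_of_mem_roots (hp : PosRooted p) {z : ℂ} (hz : z ∈ p.roots) :
    ∃ r : ℝ, 0 < r ∧ z = r :=
  hp.2 z (isRoot_of_mem_roots hz)

lemma im_mul_im_logDeriv_nonpos (hp : PosRooted p) (hw : p.eval w ≠ 0) :
    w.im * (logDeriv (fun z => p.eval z) w).im ≤ 0 := by
  rw [logDeriv_eval_eq_sum_roots hw]
  refine Multiset.sum_induction (fun s : ℂ => w.im * s.im ≤ 0) _
    (fun s t hs ht => by rw [Complex.add_im]; linarith) (by simp) fun s hs => ?_
  obtain ⟨z, hz, rfl⟩ := Multiset.mem_map.1 hs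
  obtain ⟨r, -, rfl⟩ := hp.exists_pos_of_mem_roots hz
  simp only [one_div, Complex.inv_im, Complex.sub_im, Complex.ofReal_im, sub_zero]
  rw [mul_div_assoc', mul_neg]
  exact div_nonpos_of_nonpos_of_nonneg (by nlinarith) (Complex.normSq_nonneg _)

lemma re_logDeriv_nonpos (hp : PosRooted p) (hw : p.eval w ≠ 0) (hre : w.re ≤ 0) :
    (logDeriv (fun z => p.eval z) w).re ≤ 0 := by
  rw [logDeriv_eval_eq_sum_roots hw]
  refine Multiset.sum_induction (fun s : ℂ => s.re ≤ 0) _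
    (fun s t hs ht => by rw [Complex.add_re]; linarith) (by simp) fun s hs => ?_
  obtain ⟨z, hz, rfl⟩ := Multiset.mem_map.1 hs
  obtain ⟨r, hr, rfl⟩ := hp.exists_pos_of_mem_roots hz
  simp only [one_div, Complex.inv_re, Complex.sub_re, Complex.ofReal_re]
  exact div_nonpos_of_nonpos_of_nonneg (by linarith) (Complex.normSq_nonneg _)

-- At a zero `w` of `eulerOp A B p` with `p w ≠ 0`, dividing by `w p(w)` gives
-- `1 / w + B p'(w) / p(w) = A`, which fixes the signs of both coordinates of `w`.
protected lemma eulerOp (hp : PosRooted p) {A B : ℝ} (hA : 0 ≤ A) (hB : 0 ≤ B) :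
    PosRooted (eulerOp A B p) := by
  refine ⟨by simp [eval_eulerOp, hp.1], fun w hw => ?_⟩
  by_cases hpw : p.eval w = 0
  · exact hp.2 w hpw
  rw [eval_eulerOp] at hw
  have hw0 : w ≠ 0 := by
    rintro rfl
    simp [hp.1] at hw
  set D := logDeriv (fun z => p.eval z) w with hD
  have hsum : w⁻¹ + B * D = A := by
    rw [hD, logDeriv_apply, Polynomial.deriv]
    field_simp
    linear_combination hw
  have hn : 0 < Complex.normSq w := Complex.normSq_pos.2 hw0
  have him : w.im = 0 := by
    have h1 : -w.im / Complex.normSq w + B * D.im = 0 := by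
      simpa using congrArg Complex.im hsum
    have h2 : w.im * (B * D.im) ≤ 0 := by
      nlinarith [mul_nonpos_of_nonneg_of_nonpos hB (hp.im_mul_im_logDeriv_nonpos hpw)]
    field_simp at h1
    nlinarith [mul_nonpos_of_nonneg_of_nonpos hn.le h2, sq_nonneg w.im]
  have hre : 0 < w.re := by
    by_contra! hre
    have h1 : w.re / Complex.normSq w + B * D.re = A := by
      simpa using congrArg Complex.re hsum
    have h2 : w.re < 0 := lt_of_le_of_ne hre fun h => hw0 (Complex.ext h him)
    nlinarith [mul_nonpos_of_nonneg_of_nonpos hB (hp.re_logDeriv_nonpos hpw hre),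
      div_neg_of_neg_of_pos h2 hn]
  exact ⟨w.re, hre, Complex.ext rfl (by simp [him])⟩

lemma norm_eval_norm_le (hp : PosRooted p) (w : ℂ) : ‖p.eval (‖w‖ : ℂ)‖ ≤ ‖p.eval w‖ := by
  have hprod : ∀ s : Multiset ℂ, ‖s.prod‖ = (s.map norm).prod :=
    map_multiset_prod (normHom : ℂ →*₀ ℝ)
  simp only [(IsAlgClosed.splits p).eval_eq_prod_roots, norm_mul, hprod, Multiset.map_map]
  refine mul_le_mul_of_nonneg_left (Multiset.prod_map_le_prod_map₀ _ _
    (fun _ _ => norm_nonneg _) fun z hz => ?_) (norm_nonneg _)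
  obtain ⟨r, hr, rfl⟩ := hp.exists_pos_of_mem_roots hz
  simpa [← Complex.ofReal_sub, abs_of_pos hr] using abs_norm_sub_norm_le w (r : ℂ)

lemma norm_logDeriv_le (hp : PosRooted p) {R : ℝ} (hR : ∀ t ∈ Icc 0 R, p.eval (t : ℂ) ≠ 0)
    (hw : ‖w‖ ≤ R) :
    ‖logDeriv (fun z => p.eval z) w‖ ≤ -(logDeriv (fun z => p.eval z) (R : ℂ)).re := by
  have hw0 : p.eval w ≠ 0 := by
    have := (norm_pos_iff.2 (hR ‖w‖ ⟨norm_nonneg w, hw⟩)).trans_le (hp.norm_eval_norm_le w)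
    exact norm_pos_iff.1 this
  rw [logDeriv_eval_eq_sum_roots hw0,
    logDeriv_eval_eq_sum_roots (hR R ⟨(norm_nonneg w).trans hw, le_rfl⟩)]
  have hterm : ∀ z ∈ p.roots, ‖1 / (w - z)‖ ≤ -(1 / ((R : ℂ) - z)).re := by
    intro z hz
    obtain ⟨r, hr, rfl⟩ := hp.exists_pos_of_mem_roots hz
    have hRr : R < r := by
      by_contra! h
      exact hR r ⟨hr.le, h⟩ (isRoot_of_mem_roots hz)
    have hdist : r - R ≤ ‖w - r‖ := by
      have := norm_sub_norm_le (r : ℂ) w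
      rw [norm_sub_rev, Complex.norm_of_nonneg hr.le] at this
      linarith
    have hval : -(1 / ((R : ℂ) - r)).re = 1 / (r - R) := by
      rw [← Complex.ofReal_sub, ← Complex.ofReal_one, ← Complex.ofReal_div, Complex.ofReal_re,
        ← neg_sub r R, div_neg, neg_neg]
    rw [hval, norm_div, norm_one]
    exact one_div_le_one_div_of_le (by linarith) hdist
  calc ‖(p.roots.map fun r => 1 / (w - r)).sum‖
      ≤ ((p.roots.map fun r => 1 / (w - r)).map fun s => ‖s‖).sum := norm_multiset_sum_le _
    _ ≤ (p.roots.map fun r => -(1 / ((R : ℂ) - r)).re).sum := by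
        rw [Multiset.map_map]
        exact Multiset.sum_map_le_sum_map _ _ hterm
    _ = -((p.roots.map fun r => 1 / ((R : ℂ) - r)).sum).re := by
        rw [Multiset.sum_map_neg, ← Complex.coe_reAddGroupHom, map_multiset_sum,
          Multiset.map_map]
        rfl

end PosRooted

end PositiveRoots

lemma eventually_forall_ne_zero_of_tendstoUniformlyOn {ι X E : Type*} [TopologicalSpace X]
    [NormedAddCommGroup E] {F : ι → X → E} {f : X → E} {l : Filter ι} {K : Set X}
    (hF : TendstoUniformlyOn F f l K) (hK : IsCompact K) (hf : ContinuousOn f K)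
    (h0 : ∀ x ∈ K, f x ≠ 0) : ∀ᶠ i in l, ∀ x ∈ K, F i x ≠ 0 := by
  obtain ⟨m, hm, hmf⟩ := hK.exists_forall_le' hf.norm fun x hx => norm_pos_iff.2 (h0 x hx)
  filter_upwards [Metric.tendstoUniformlyOn_iff.1 hF m hm] with i hi x hx hFx
  have := hi x hx
  rw [hFx, dist_zero_right] at this
  exact (hmf x hx).not_gt this

/-- Locally uniform limits on the plane of polynomials in the class `PosRooted`; these are entire
functions of Laguerre–Pólya type with positive zeros only. -/
def PosRootedLimit (W : ℂ → ℂ) : Prop :=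
  ∃ P : ℕ → Polynomial ℂ, (∀ N, PosRooted (P N)) ∧
    TendstoLocallyUniformlyOn (fun N w => (P N).eval w) W atTop univ

namespace PosRootedLimit

variable {W : ℂ → ℂ}

lemma differentiable (hW : PosRootedLimit W) : Differentiable ℂ W := by
  obtain ⟨P, -, hP⟩ := hW
  exact differentiableOn_univ.1 (hP.differentiableOn
    (Eventually.of_forall fun N => (P N).differentiableOn) isOpen_univ)

lemma map_zero (hW : PosRootedLimit W) : W 0 = 1 := by
  obtain ⟨P, hpos, hP⟩ := hW
  refine tendsto_nhds_unique (hP.tendsto_at (mem_univ 0)) ?_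
  simp only [(hpos _).1, tendsto_const_nhds]

lemma norm_map_norm_le (hW : PosRootedLimit W) (w : ℂ) : ‖W ‖w‖‖ ≤ ‖W w‖ := by
  obtain ⟨P, hpos, hP⟩ := hW
  exact le_of_tendsto_of_tendsto' (hP.tendsto_at (mem_univ _)).norm
    (hP.tendsto_at (mem_univ _)).norm fun N => (hpos N).norm_eval_norm_le w

lemma euler (hW : PosRootedLimit W) {A B : ℝ} (hA : 0 ≤ A) (hB : 0 ≤ B) :
    PosRootedLimit fun w => W w + B * w * deriv W w - A * w * W w := by
  have hd := hW.differentiable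
  obtain ⟨P, hpos, hP⟩ := hW
  refine ⟨fun N => eulerOp A B (P N), fun N => (hpos N).eulerOp hA hB, ?_⟩
  have hmul (C : ℝ) {F : ℕ → ℂ → ℂ} {f : ℂ → ℂ}
      (hF : TendstoLocallyUniformlyOn F f atTop univ) (hf : Continuous f) :
      TendstoLocallyUniformlyOn (fun N w => (C * w) * F N w) (fun w => (C * w) * f w)
        atTop univ := by
    have hconst : TendstoLocallyUniformlyOn (fun (_ : ℕ) (w : ℂ) => (C : ℂ) * w)
        (fun w => C * w) atTop univ :=
      TendstoUniformlyOn.tendstoLocallyUniformlyOn fun u hu =>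
        Eventually.of_forall fun _ _ _ => refl_mem_uniformity hu
    exact hconst.mul₀ hF (by fun_prop) hf.continuousOn
  have hP' : TendstoLocallyUniformlyOn (fun N w => (P N).derivative.eval w) (deriv W)
      atTop univ :=
    (hP.deriv (Eventually.of_forall fun N => (P N).differentiableOn) isOpen_univ).congr
      fun N w _ => (P N).deriv
  have hlim := (hP.add (hmul B hP' (hd.contDiff (n := 1)).continuous_deriv_one)).sub
    (hmul A hP hd.continuous)
  exact hlim.congr fun N w _ => (eval_eulerOp A B (P N) w).symm

lemma map_ne_zero (hW : PosRootedLimit W) {R : ℝ} (hR : ∀ t ∈ Icc 0 R, W (t : ℂ) ≠ 0) {w : ℂ}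
    (hw : ‖w‖ ≤ R) : W w ≠ 0 :=
  norm_pos_iff.1 <|
    (norm_pos_iff.2 (hR ‖w‖ ⟨norm_nonneg w, hw⟩)).trans_le (hW.norm_map_norm_le w)

lemma norm_logDeriv_le (hW : PosRootedLimit W) {R : ℝ} (hR : ∀ t ∈ Icc 0 R, W (t : ℂ) ≠ 0)
    {w : ℂ} (hw : ‖w‖ ≤ R) : ‖logDeriv W w‖ ≤ -(logDeriv W R).re := by
  have hd := hW.differentiable
  have hw0 := hW.map_ne_zero hR hw
  have hR0 := hR R ⟨(norm_nonneg w).trans hw, le_rfl⟩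
  obtain ⟨P, hpos, hP⟩ := hW
  have hlog {z : ℂ} (hz : W z ≠ 0) :
      Tendsto (fun N => logDeriv (fun z => (P N).eval z) z) atTop (𝓝 (logDeriv W z)) :=
    Complex.logDeriv_tendsto isOpen_univ (mem_univ z) hP
      (Eventually.of_forall fun N => (P N).differentiableOn) hz
  have hK : IsCompact ((fun t : ℝ => (t : ℂ)) '' Icc 0 R) :=
    isCompact_Icc.image Complex.continuous_ofReal
  have hne := eventually_forall_ne_zero_of_tendstoUniformlyOn
    ((tendstoLocallyUniformlyOn_iff_forall_isCompact isOpen_univ).1 hP _ (subset_univ _) hK) hK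
    hd.continuous.continuousOn (forall_mem_image.2 hR)
  refine le_of_tendsto_of_tendsto (hlog hw0).norm
    ((Complex.continuous_re.tendsto _).comp (hlog hR0)).neg (hne.mono fun N hN => ?_)
  exact (hpos N).norm_logDeriv_le (fun t ht => hN _ (mem_image_of_mem _ ht)) hw

end PosRootedLimit

/-- `f` is the entire function with Taylor coefficients `c` at the origin. -/
def HasEntireSeries (c : ℕ → ℂ) (f : ℂ → ℂ) : Prop :=
  ∀ w, HasSum (fun n => c n * w ^ n) (f w)

lemma hasEntireSeries_polynomial (p : Polynomial ℂ) :
    HasEntireSeries p.coeff fun w => p.eval w := fun w => by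
  simp only [Polynomial.eval_eq_sum_range]
  refine hasSum_sum_of_ne_finset_zero fun n hn => ?_
  rw [Polynomial.coeff_eq_zero_of_natDegree_lt (by simpa using hn), zero_mul]

lemma norm_mul_pow_le_of_norm_le {c w : ℂ} {R : ℝ} (hw : ‖w‖ ≤ R) (n : ℕ) :
    ‖c * w ^ n‖ ≤ ‖c‖ * R ^ n := by
  rw [norm_mul, norm_pow]
  gcongr

namespace HasEntireSeries

variable {c d : ℕ → ℂ} {f g : ℂ → ℂ}

lemma unique (hf : HasEntireSeries c f) (hg : HasEntireSeries c g) : f = g :=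
  funext fun w => (hf w).unique (hg w)

lemma tsum_eq (hf : HasEntireSeries c f) : (fun w => ∑' n, c n * w ^ n) = f :=
  funext fun w => (hf w).tsum_eq

lemma of_norm_le {u : ℕ → ℝ} (hc : ∀ n, ‖c n‖ ≤ u n)
    (hu : ∀ R : ℝ, 0 ≤ R → Summable fun n => u n * R ^ n) :
    HasEntireSeries c fun w => ∑' n, c n * w ^ n := fun w =>
  (Summable.of_norm_bounded (hu ‖w‖ (norm_nonneg w)) fun n =>
    (norm_mul_pow_le_of_norm_le le_rfl n).trans (by gcongr; exact hc n)).hasSum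

lemma congr_coeff (hf : HasEntireSeries c f) (h : ∀ n, c n = d n) : HasEntireSeries d f :=
  funext h ▸ hf

lemma add (hf : HasEntireSeries c f) (hg : HasEntireSeries d g) :
    HasEntireSeries (fun n => c n + d n) fun w => f w + g w := fun w => by
  simpa only [add_mul] using (hf w).add (hg w)

lemma const_mul (hf : HasEntireSeries c f) (k : ℂ) :
    HasEntireSeries (fun n => k * c n) fun w => k * f w := fun w => by
  simpa only [mul_assoc] using (hf w).mul_left k

lemma id_mul (hf : HasEntireSeries c f) (h0 : d 0 = 0) (hd : ∀ n, d (n + 1) = c n) :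
    HasEntireSeries d fun w => w * f w := fun w => by
  rw [← hasSum_nat_add_iff' 1]
  simpa [h0, hd, pow_succ', mul_left_comm] using (hf w).mul_left w

lemma summable_norm_mul_pow (hf : HasEntireSeries c f) {R : ℝ} (hR : 0 ≤ R) :
    Summable fun n => ‖c n‖ * R ^ n := by
  simpa [abs_of_nonneg hR] using (hf R).summable.norm

lemma differentiable (hf : HasEntireSeries c f) : Differentiable ℂ f := fun w => by
  have hw : w ∈ Metric.ball (0 : ℂ) (‖w‖ + 1) := by simp
  have hdiff : DifferentiableOn ℂ (fun z => ∑' n, c n * z ^ n) (Metric.ball 0 (‖w‖ + 1)) :=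
    Complex.differentiableOn_tsum_of_summable_norm
      (hf.summable_norm_mul_pow (by positivity : 0 ≤ ‖w‖ + 1)) (fun n => by fun_prop)
      Metric.isOpen_ball fun n z hz =>
        norm_mul_pow_le_of_norm_le (mem_ball_zero_iff.1 hz).le n
  rw [hf.tsum_eq] at hdiff
  exact hdiff.differentiableAt (Metric.isOpen_ball.mem_nhds hw)

lemma id_mul_deriv (hf : HasEntireSeries c f) :
    HasEntireSeries (fun n => n * c n) fun w => w * deriv f w := fun w => by
  have hw : w ∈ Metric.ball (0 : ℂ) (‖w‖ + 1) := by simp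
  have hderiv := Complex.hasSum_deriv_of_summable_norm (F := fun n z => c n * z ^ n)
    (hf.summable_norm_mul_pow (by positivity : 0 ≤ ‖w‖ + 1)) (fun n => by fun_prop)
    Metric.isOpen_ball (fun n z hz =>
      norm_mul_pow_le_of_norm_le (mem_ball_zero_iff.1 hz).le n) hw
  rw [hf.tsum_eq] at hderiv
  refine (hderiv.mul_left w).congr_fun fun n => ?_
  rcases n with _ | n
  · simp
  · simp only [deriv_const_mul_field, deriv_pow_field, Nat.add_sub_cancel]
    ring

theorem tendstoLocallyUniformlyOn {ι : Type*} {l : Filter ι} {F : ι → ℂ → ℂ} {a : ι → ℕ → ℂ}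
    {u : ℕ → ℝ} (hF : ∀ i, HasEntireSeries (a i) (F i)) (hf : HasEntireSeries c f)
    (hu : ∀ R : ℝ, 0 ≤ R → Summable fun n => u n * R ^ n)
    (ha : ∀ᶠ i in l, ∀ n, ‖a i n‖ ≤ u n) (hc : ∀ n, Tendsto (fun i => a i n) l (𝓝 (c n))) :
    TendstoLocallyUniformlyOn F f l univ := by
  rw [tendstoLocallyUniformlyOn_iff_forall_isCompact isOpen_univ]
  intro K _ hK
  obtain ⟨R, hR, hKR⟩ := hK.isBounded.exists_pos_norm_le
  have hbound : ∀ᶠ i in l, ∀ n, ‖a i n - c n‖ * R ^ n ≤ (u n + ‖c n‖) * R ^ n :=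
    ha.mono fun i hi n => by
      gcongr
      exact (norm_sub_le _ _).trans (by gcongr; exact hi n)
  have hsum : Summable fun n => (u n + ‖c n‖) * R ^ n := by
    simpa only [add_mul] using (hu R hR.le).add (hf.summable_norm_mul_pow hR.le)
  have hlim : Tendsto (fun i => ∑' n, ‖a i n - c n‖ * R ^ n) l (𝓝 0) := by
    simpa using tendsto_tsum_of_dominated_convergence
      (f := fun i n => ‖a i n - c n‖ * R ^ n) (g := fun _ => 0) hsum
      (fun n => by simpa using ((hc n).sub_const (c n)).norm.mul_const (R ^ n))
      (hbound.mono fun i hi n => by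
        rw [Real.norm_of_nonneg (by positivity)]
        exact hi n)
  rw [Metric.tendstoUniformlyOn_iff]
  intro ε hε
  filter_upwards [hbound, hlim.eventually_lt_const hε] with i hi hlt w hw
  refine lt_of_le_of_lt ?_ hlt
  have hsub := (hF i w).sub (hf w)
  rw [dist_comm, dist_eq_norm, ← hsub.tsum_eq]
  refine tsum_of_norm_bounded
    (Summable.of_nonneg_of_le (fun n => by positivity) hi hsum).hasSum fun n => ?_
  rw [← sub_mul]
  exact norm_mul_pow_le_of_norm_le (hKR w hw) n

end HasEntireSeries

section BesselSeries

open Polynomial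

lemma coeff_eulerOp_zero (B : ℝ) (p : ℂ[X]) (n : ℕ) :
    (eulerOp 0 B p).coeff n = (1 + B * n) * p.coeff n := by
  cases n with
  | zero => simp [eulerOp, mul_assoc]
  | succ n =>
    simp only [eulerOp, mul_assoc, coeff_sub, coeff_add, coeff_C_mul, coeff_X_mul,
      coeff_derivative]
    push_cast
    ring

lemma coeff_one_sub_C_mul_X_pow (s : ℂ) (N n : ℕ) :
    ((1 - C s * X : ℂ[X]) ^ N).coeff n = N.choose n * (-s) ^ n := by
  rw [show (1 - C s * X : ℂ[X]) ^ N = ((1 + X) ^ N : ℂ[X]).comp (C (-s) * X) by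
    simp [sub_eq_add_neg], comp_C_mul_X_coeff, coeff_one_add_X_pow]

lemma posRooted_one_sub_C_mul_X_pow {s : ℝ} (hs : 0 ≤ s) (N : ℕ) :
    PosRooted ((1 - C (s : ℂ) * X) ^ N) := by
  induction N with
  | zero => simp [PosRooted]
  | succ N ih =>
    convert ih.eulerOp hs le_rfl using 1
    simp only [eulerOp, Complex.ofReal_zero, C_0]
    ring

lemma PosRooted.exists_coeff_eq_prod_mul {p : ℂ[X]} (hp : PosRooted p) {B : ℕ → ℝ}
    (hB : ∀ j, 0 ≤ B j) (m : ℕ) : ∃ q, PosRooted q ∧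
      ∀ n, q.coeff n = (∏ j ∈ Finset.range m, (1 + B j * n) : ℝ) * p.coeff n := by
  induction m with
  | zero => exact ⟨p, hp, by simp⟩
  | succ m ih =>
    obtain ⟨q, hq, hcoeff⟩ := ih
    refine ⟨eulerOp 0 (B m) q, hq.eulerOp le_rfl (hB m), fun n => ?_⟩
    rw [coeff_eulerOp_zero, hcoeff, Finset.prod_range_succ]
    push_cast
    ring

lemma ascPochhammer_eval_eq_prod_range {R : Type*} [CommSemiring R] (n : ℕ) (x : R) :
    (ascPochhammer R n).eval x = ∏ k ∈ Finset.range n, (x + k) := by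
  induction n with
  | zero => simp
  | succ n ih => rw [ascPochhammer_succ_eval, Finset.prod_range_succ, ih]

lemma prod_one_add_div_eq {x : ℝ} (hx : 0 < x) (N n : ℕ) :
    ∏ j ∈ Finset.range N, (1 + (n : ℝ) / (x + j)) =
      (ascPochhammer ℝ (n + N)).eval x /
        ((ascPochhammer ℝ n).eval x * (ascPochhammer ℝ N).eval x) := by
  have hpos := fun m => ascPochhammer_pos m x hx
  induction N with
  | zero => simp [(hpos n).ne']
  | succ N ih =>
    have hN := (hpos N).ne'
    have hn := (hpos n).ne'
    have hxN : x + N ≠ 0 := by positivity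
    rw [Finset.prod_range_succ, ih, ← add_assoc, ascPochhammer_succ_eval,
      ascPochhammer_succ_eval]
    push_cast
    field_simp
    ring

lemma prod_one_add_div_comm {x : ℝ} (hx : 0 < x) (N n : ℕ) :
    ∏ j ∈ Finset.range N, (1 + (n : ℝ) / (x + j)) =
      ∏ k ∈ Finset.range n, (1 + (N : ℝ) / (x + k)) := by
  rw [prod_one_add_div_eq hx, prod_one_add_div_eq hx, add_comm, mul_comm]

/-- The Taylor coefficients of `₀F₁(; x; -w / 4)`. -/
noncomputable def besselCoeff (x : ℝ) (n : ℕ) : ℝ :=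
  (-1 / 4) ^ n / (n.factorial * (ascPochhammer ℝ n).eval x)

/-- The hypergeometric function `₀F₁(; x; -w / 4)`. For `x = ν + 1` it is the entire part of the
Bessel function: `J_ν(z) = (z / 2) ^ ν / Γ(ν + 1) * besselSeries (ν + 1) (z ^ 2)`. -/
noncomputable def besselSeries (x : ℝ) (w : ℂ) : ℂ :=
  ∑' n, (besselCoeff x n : ℂ) * w ^ n

/-- The `n`-th coefficient of the `N`-th (Jacobi) polynomial approximating `besselSeries x`. -/
noncomputable def besselApproxCoeff (x : ℝ) (N n : ℕ) : ℝ :=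
  N.choose n * (-1 / (4 * N ^ 2)) ^ n * ∏ k ∈ Finset.range n, (1 + N / (x + k))

variable {x : ℝ}

lemma exists_posRooted_coeff_eq_besselApproxCoeff (hx : 0 < x) (N : ℕ) :
    ∃ p : ℂ[X], PosRooted p ∧ ∀ n, p.coeff n = besselApproxCoeff x N n := by
  obtain ⟨p, hp, hcoeff⟩ := (posRooted_one_sub_C_mul_X_pow
    (by positivity : 0 ≤ 1 / (4 * (N : ℝ) ^ 2)) N).exists_coeff_eq_prod_mul
    (fun j => by positivity : ∀ j : ℕ, 0 ≤ 1 / (x + j)) N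
  refine ⟨p, hp, fun n => ?_⟩
  rw [hcoeff, coeff_one_sub_C_mul_X_pow, besselApproxCoeff, ← prod_one_add_div_comm hx]
  simp only [one_div_mul_eq_div]
  push_cast
  ring

lemma besselApproxCoeff_eq {N : ℕ} (hN : N ≠ 0) (n : ℕ) :
    besselApproxCoeff x N n =
      N.choose n * (-1 / 4 / N) ^ n * ∏ k ∈ Finset.range n, (1 / (N : ℝ) + 1 / (x + k)) := by
  have hN' : (N : ℝ) ≠ 0 := Nat.cast_ne_zero.2 hN
  have hprod : ∏ k ∈ Finset.range n, (1 + N / (x + k)) =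
      N ^ n * ∏ k ∈ Finset.range n, (1 / (N : ℝ) + 1 / (x + k)) := by
    have hpow := (Finset.range n).pow_card_mul_prod
      (f := fun k : ℕ => 1 / (N : ℝ) + 1 / (x + k)) (b := (N : ℝ))
    rw [Finset.card_range] at hpow
    rw [hpow]
    refine Finset.prod_congr rfl fun k _ => ?_
    field_simp
  rw [besselApproxCoeff, hprod, ← mul_assoc, mul_assoc (N.choose n : ℝ), ← mul_pow]
  congr 3
  field_simp

lemma norm_besselApproxCoeff_le (hx : 0 < x) {N : ℕ} (hN : N ≠ 0) (n : ℕ) :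
    ‖besselApproxCoeff x N n‖ ≤ ((1 + 1 / x) / 4) ^ n / n.factorial := by
  have hN' : (0 : ℝ) < N := by positivity
  have hprod : ∏ k ∈ Finset.range n, (1 / (N : ℝ) + 1 / (x + k)) ≤ (1 + 1 / x) ^ n := by
    rw [← Finset.card_range n, ← Finset.prod_const, Finset.card_range]
    refine Finset.prod_le_prod (fun k _ => by positivity) fun k _ => ?_
    gcongr
    · exact (div_le_one hN').2 (by exact_mod_cast Nat.one_le_iff_ne_zero.2 hN)
    · exact le_add_of_nonneg_right (by positivity)
  rw [besselApproxCoeff_eq hN, norm_mul, norm_mul, norm_pow, Real.norm_natCast,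
    Real.norm_of_nonneg (Finset.prod_nonneg fun k _ => by positivity)]
  have hbase : ‖(-1 / 4 / N : ℝ)‖ = 1 / (4 * N) := by
    rw [norm_div, norm_div, Real.norm_natCast]
    norm_num
    ring
  calc N.choose n * ‖(-1 / 4 / N : ℝ)‖ ^ n * ∏ k ∈ Finset.range n, (1 / (N : ℝ) + 1 / (x + k))
      ≤ N ^ n / n.factorial * (1 / (4 * N)) ^ n * (1 + 1 / x) ^ n := by
        rw [hbase]
        gcongr
        exact Nat.choose_le_pow_div n N
    _ = ((1 + 1 / x) / 4) ^ n / n.factorial := by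
        rw [show (1 + 1 / x) / 4 = N * (1 / (4 * N)) * (1 + 1 / x) by field_simp, mul_pow, mul_pow]
        ring

lemma tendsto_besselApproxCoeff (n : ℕ) :
    Tendsto (fun N => besselApproxCoeff x N n) atTop (𝓝 (besselCoeff x n)) := by
  have hchoose := ProbabilityTheory.tendsto_choose_mul_pow_atTop n
    (p := fun N => -1 / 4 / N) (r := -1 / 4) (by
      refine tendsto_const_nhds.congr' ?_
      filter_upwards [eventually_ne_atTop 0] with N hN
      field_simp)
  have hprod : Tendsto (fun N : ℕ => ∏ k ∈ Finset.range n, (1 / (N : ℝ) + 1 / (x + k))) atTop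
      (𝓝 (∏ k ∈ Finset.range n, (0 + 1 / (x + k)))) :=
    tendsto_finsetProd _ fun k _ => (tendsto_const_div_atTop_nhds_zero_nat 1).add_const _
  have hval : (-1 / 4 : ℝ) ^ n / n.factorial * ∏ k ∈ Finset.range n, (0 + 1 / (x + k)) =
      besselCoeff x n := by
    simp only [zero_add, one_div, Finset.prod_inv_distrib, besselCoeff,
      ascPochhammer_eval_eq_prod_range]
    field_simp
  rw [← hval]
  refine (hchoose.mul hprod).congr' ?_
  filter_upwards [eventually_ne_atTop 0] with N hN
  rw [besselApproxCoeff_eq hN]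

lemma summable_pow_div_factorial_mul_pow (C R : ℝ) :
    Summable fun n : ℕ => C ^ n / n.factorial * R ^ n := by
  simpa only [mul_pow, mul_div_right_comm] using Real.summable_pow_div_factorial (C * R)

lemma hasEntireSeries_besselSeries (hx : 0 < x) :
    HasEntireSeries (fun n => (besselCoeff x n : ℂ)) (besselSeries x) :=
  HasEntireSeries.of_norm_le (u := fun n => ((1 + 1 / x) / 4) ^ n / n.factorial) (fun n => by
    rw [Complex.norm_real]
    exact le_of_tendsto (tendsto_besselApproxCoeff n).norm
      ((eventually_ne_atTop 0).mono fun N hN => norm_besselApproxCoeff_le hx hN n))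
    fun R _ => summable_pow_div_factorial_mul_pow _ R

theorem posRootedLimit_besselSeries (hx : 0 < x) : PosRootedLimit (besselSeries x) := by
  choose P hP hcoeff using exists_posRooted_coeff_eq_besselApproxCoeff hx
  refine ⟨P, hP, HasEntireSeries.tendstoLocallyUniformlyOn
    (fun N => hasEntireSeries_polynomial (P N)) (hasEntireSeries_besselSeries hx)
    (fun R _ => summable_pow_div_factorial_mul_pow ((1 + 1 / x) / 4) R) ?_ fun n => ?_⟩
  · filter_upwards [eventually_ne_atTop 0] with N hN n
    rw [hcoeff, Complex.norm_real]
    exact norm_besselApproxCoeff_le hx hN n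
  · simp only [hcoeff]
    exact (Complex.continuous_ofReal.tendsto _).comp (tendsto_besselApproxCoeff n)

lemma besselCoeff_succ (hx : 0 < x) (n : ℕ) :
    4 * (n + 1) * (n + x) * besselCoeff x (n + 1) = -besselCoeff x n := by
  have hpos := (ascPochhammer_pos n x hx).ne'
  have hxn : x + n ≠ 0 := by positivity
  rw [besselCoeff, besselCoeff, ascPochhammer_succ_eval, Nat.factorial_succ]
  push_cast
  field_simp
  ring

end BesselSeries

section BesselNSeries

/-- The operator `ν + 2 θ`, where `θ F(w) = w F'(w)`. It describes the action of `z d/dz` on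
functions of the form `z ^ ν * F (z ^ 2)`. -/
noncomputable def eulerShift (ν : ℝ) (F : ℂ → ℂ) (w : ℂ) : ℂ :=
  ν * F w + 2 * (w * deriv F w)

/-- The entire part `W` of the normalized `N_ν`, for which
`normConst a b c ν * N_ν(z) = z ^ ν * W (z ^ 2)` and `W 0 = 1`. -/
noncomputable def besselNSeries (a b c ν : ℝ) (w : ℂ) : ℂ :=
  (quadQ a b c ν : ℂ)⁻¹ * (a * eulerShift ν (eulerShift ν (besselSeries (ν + 1))) w +
    (b - a) * eulerShift ν (besselSeries (ν + 1)) w + c * besselSeries (ν + 1) w)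

lemma HasEntireSeries.eulerShift {c : ℕ → ℂ} {F : ℂ → ℂ} (hF : HasEntireSeries c F) (ν : ℝ) :
    HasEntireSeries (fun n => (ν + 2 * n) * c n) (eulerShift ν F) :=
  ((hF.const_mul ν).add (hF.id_mul_deriv.const_mul 2)).congr_coeff fun n => by ring

lemma PosRootedLimit.of_coeff_mul {c d : ℕ → ℂ} {F G : ℂ → ℂ} (hF : PosRootedLimit F)
    (hc : HasEntireSeries c F) (hd : HasEntireSeries d G) {B : ℝ} (hB : 0 ≤ B)
    (hcd : ∀ n : ℕ, d n = (1 + B * n) * c n) : PosRootedLimit G := by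
  have hseries : HasEntireSeries d fun w => F w + B * (w * deriv F w) :=
    (hc.add (hc.id_mul_deriv.const_mul B)).congr_coeff fun n => by rw [hcd]; ring
  rw [hd.unique hseries]
  simpa [mul_assoc] using hF.euler le_rfl hB

variable {a b c ν : ℝ}

lemma hasEntireSeries_besselNSeries (a b c : ℝ) (hν : -1 < ν) :
    HasEntireSeries
      (fun n => ((quadQ a b c (ν + 2 * n) / quadQ a b c ν * besselCoeff (ν + 1) n : ℝ) : ℂ))
      (besselNSeries a b c ν) := by
  have hF := hasEntireSeries_besselSeries (x := ν + 1) (by linarith)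
  refine HasEntireSeries.congr_coeff (((((hF.eulerShift ν).eulerShift ν).const_mul a).add
    ((hF.eulerShift ν).const_mul (b - a))).add (hF.const_mul c) |>.const_mul
      (quadQ a b c ν : ℂ)⁻¹) fun n => ?_
  push_cast [quadQ]
  ring

lemma posRootedLimit_besselNSeries_of_roots_lt {r₁ r₂ : ℝ} (hν : -1 < ν) (ha : a ≠ 0)
    (hroots : ∀ x, quadQ a b c x = a * (x - r₁) * (x - r₂)) (h₁ : r₁ < ν) (h₂ : r₂ < ν) :
    PosRootedLimit (besselNSeries a b c ν) := by
  have hν' : 0 < ν + 1 := by linarith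
  have h₁' : 0 < ν - r₁ := sub_pos.2 h₁
  have h₂' : 0 < ν - r₂ := sub_pos.2 h₂
  have hF := hasEntireSeries_besselSeries hν'
  have hG := (hF.add (hF.id_mul_deriv.const_mul ((2 / (ν - r₁) : ℝ) : ℂ)))
  refine PosRootedLimit.of_coeff_mul (B := 2 / (ν - r₂))
    ((posRootedLimit_besselSeries hν').of_coeff_mul hF hG (B := 2 / (ν - r₁)) (by positivity)
      fun n => by ring) hG (hasEntireSeries_besselNSeries a b c hν) (by positivity) fun n => ?_
  have hfactor : quadQ a b c (ν + 2 * n) / quadQ a b c ν =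
      (1 + 2 / (ν - r₂) * n) * (1 + 2 / (ν - r₁) * n) := by
    rw [hroots, hroots]
    field_simp
    ring
  rw [hfactor]
  push_cast
  ring

-- Bessel's equation turns the second order part of `N_ν` into multiplication by `w`.
lemma besselNSeries_eq (a b c : ℝ) (hν : -1 < ν) (hQ : quadQ a b c ν ≠ 0) (w : ℂ) :
    besselNSeries a b c ν w = besselSeries (ν + 1) w +
      (2 * ((b - a) / quadQ a b c ν) : ℝ) * w * deriv (besselSeries (ν + 1)) w -
      (a / quadQ a b c ν : ℝ) * w * besselSeries (ν + 1) w := by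
  have hν' : 0 < ν + 1 := by linarith
  have hF := hasEntireSeries_besselSeries hν'
  have hbessel : HasEntireSeries
      (fun n => ((-(4 * n * (n + ν) * besselCoeff (ν + 1) n) : ℝ) : ℂ))
      fun w => w * besselSeries (ν + 1) w :=
    hF.id_mul (by simp) fun n => by
      rw [← neg_eq_iff_eq_neg.2 (besselCoeff_succ hν' n)]
      push_cast
      ring
  have hseries := (hF.add (hF.id_mul_deriv.const_mul
    ((2 * ((b - a) / quadQ a b c ν) : ℝ) : ℂ))).add
      (hbessel.const_mul ((-(a / quadQ a b c ν) : ℝ) : ℂ))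
  rw [(hasEntireSeries_besselNSeries a b c hν).unique (hseries.congr_coeff fun n => ?_)]
  · push_cast
    ring
  · have hshift : quadQ a b c (ν + 2 * n) =
        quadQ a b c ν + 2 * (b - a) * n + a * (4 * n * (n + ν)) := by
      rw [quadQ, quadQ]
      ring
    have hQ' : (quadQ a b c ν : ℂ) ≠ 0 := Complex.ofReal_ne_zero.2 hQ
    rw [hshift]
    push_cast
    field_simp

lemma posRootedLimit_besselNSeries_of_nonneg (hν : -1 < ν) (hQ : quadQ a b c ν ≠ 0)
    (ha : 0 ≤ a / quadQ a b c ν) (hb : 0 ≤ (b - a) / quadQ a b c ν) :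
    PosRootedLimit (besselNSeries a b c ν) := by
  rw [funext (besselNSeries_eq a b c hν hQ)]
  exact (posRootedLimit_besselSeries (by linarith)).euler ha (by positivity)

-- `habc` says that the zeros of `Q` are real or lie in the closed left half-plane.
theorem posRootedLimit_besselNSeries (habc : 0 ≤ (b - a) ^ 2 - 4 * a * c ∨ 0 ≤ a * (b - a))
    (hν : -1 < ν) (hν₀ : ∀ x, quadQ a b c x = 0 → x ≤ ν) (hQ : quadQ a b c ν ≠ 0) :
    PosRootedLimit (besselNSeries a b c ν) := by
  have hlt : ∀ x, quadQ a b c x = 0 → x < ν := fun x hx =>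
    (hν₀ x hx).lt_of_ne fun h => hQ (h ▸ hx)
  rcases eq_or_ne a 0 with rfl | ha
  · refine posRootedLimit_besselNSeries_of_nonneg hν hQ (by simp) ?_
    rcases eq_or_ne b 0 with rfl | hb
    · simp
    have hroot := hlt (-c / b) (by rw [quadQ]; field_simp; ring)
    have hQb : 0 < quadQ 0 b c ν / b := by
      rw [show quadQ 0 b c ν / b = ν - -c / b by rw [quadQ]; field_simp; ring]
      exact sub_pos.2 hroot
    simpa using (inv_pos.2 hQb).le
  rcases le_or_gt 0 ((b - a) ^ 2 - 4 * a * c) with hdisc | hdisc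
  · set s := √((b - a) ^ 2 - 4 * a * c)
    have hs2 : s ^ 2 = (b - a) ^ 2 - 4 * a * c := Real.sq_sqrt hdisc
    have hroots : ∀ x, quadQ a b c x =
        a * (x - (a - b + s) / (2 * a)) * (x - (a - b - s) / (2 * a)) := fun x => by
      rw [quadQ]
      field_simp
      linear_combination hs2
    exact posRootedLimit_besselNSeries_of_roots_lt hν ha hroots (hlt _ (by simp [hroots]))
      (hlt _ (by simp [hroots]))
  · have hab := habc.resolve_left hdisc.not_ge
    have haQ : 0 < a * quadQ a b c ν := by
      rw [quadQ]
      nlinarith [sq_nonneg (2 * a * ν + (b - a))]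
    refine posRootedLimit_besselNSeries_of_nonneg hν hQ ?_ ?_
    · rw [← mul_div_mul_left _ _ ha]
      exact div_nonneg (mul_self_nonneg a) haQ.le
    · rw [← mul_div_mul_left _ _ ha]
      exact div_nonneg hab haQ.le

end BesselNSeries
section BesselFunctions

lemma Gamma_add_natCast_eq {x : ℝ} (hx : 0 < x) (n : ℕ) :
    Complex.Gamma (x + n) = ((Real.Gamma x * (ascPochhammer ℝ n).eval x : ℝ) : ℂ) := by
  have hΓ : Complex.Gamma x ≠ 0 := Complex.Gamma_ne_zero_of_re_pos (by simpa using hx)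
  have hx' : ∀ k : ℕ, (x : ℂ) ≠ -k := fun k h => by
    have : x = -k := by exact_mod_cast h
    linarith [k.cast_nonneg (α := ℝ)]
  rw [← div_mul_cancel₀ (Complex.Gamma (x + n)) hΓ, Complex.Gamma_add_nat_div_Gamma_eq _ hx',
    Complex.Gamma_ofReal, ascPochhammer_eval_eq_prod_range, ascPochhammer_eval_eq_prod_range]
  push_cast
  ring

lemma ofReal_mul_cpow {r : ℝ} (hr : 0 < r) {z : ℂ} (hz : z ≠ 0) (s : ℂ) :
    (r * z) ^ s = (r : ℂ) ^ s * z ^ s := by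
  have hr' : (r : ℂ) ≠ 0 := Complex.ofReal_ne_zero.2 hr.ne'
  rw [Complex.cpow_def_of_ne_zero (mul_ne_zero hr' hz), Complex.log_ofReal_mul hr hz,
    Complex.ofReal_log hr.le, add_mul, Complex.exp_add, ← Complex.cpow_def_of_ne_zero hr',
    ← Complex.cpow_def_of_ne_zero hz]

lemma half_cpow_ofReal {z : ℂ} (hz : z ≠ 0) (ν : ℝ) :
    (z / 2) ^ (ν : ℂ) = z ^ (ν : ℂ) / ((2 ^ ν : ℝ) : ℂ) := by
  rw [show z / 2 = ((2⁻¹ : ℝ) : ℂ) * z by push_cast; ring, ofReal_mul_cpow (by norm_num) hz,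
    ← Complex.ofReal_cpow (by norm_num), Real.inv_rpow zero_le_two]
  push_cast
  ring

variable {a b c ν : ℝ} {z : ℂ}

lemma besselJ_eq (hν : -1 < ν) (hz : z ≠ 0) :
    besselJ ν z = ((2 ^ ν * Real.Gamma (ν + 1) : ℝ) : ℂ)⁻¹ *
      (z ^ (ν : ℂ) * besselSeries (ν + 1) (z ^ 2)) := by
  have hν' : 0 < ν + 1 := by linarith
  rw [besselJ, besselSeries, ← mul_assoc, ← tsum_mul_left]
  refine tsum_congr fun n => ?_
  have hΓ : Complex.Gamma (n + ν + 1) =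
      ((Real.Gamma (ν + 1) * (ascPochhammer ℝ n).eval (ν + 1) : ℝ) : ℂ) := by
    rw [← Gamma_add_natCast_eq hν', show ((n : ℂ) + ν + 1) = ((ν + 1 : ℝ) : ℂ) + n by
      push_cast; ring]
  have hpow : (z / 2) ^ (2 * (n : ℂ)) = (z ^ 2) ^ n * (1 / 4) ^ n := by
    rw [Complex.cpow_ofNat_mul, Complex.cpow_natCast, ← mul_pow, ← pow_mul, mul_comm, pow_mul]
    ring
  rw [Complex.cpow_add _ _ (div_ne_zero hz two_ne_zero), half_cpow_ofReal hz, hpow, hΓ,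
    besselCoeff, show (-1 / 4 : ℝ) ^ n = (-1) ^ n * (1 / 4) ^ n by rw [← mul_pow]; norm_num]
  push_cast
  ring

lemma mul_deriv_of_eqOn_cpow_mul_comp_sq {K : ℂ} {F f : ℂ → ℂ} (hF : Differentiable ℂ F)
    (hf : ∀ z ∈ Complex.slitPlane, f z = K * (z ^ (ν : ℂ) * F (z ^ 2)))
    (hz : z ∈ Complex.slitPlane) :
    DifferentiableAt ℂ f z ∧ z * deriv f z = K * (z ^ (ν : ℂ) * eulerShift ν F (z ^ 2)) := by
  have hz0 := Complex.slitPlane_ne_zero hz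
  have hpow : HasDerivAt (fun z : ℂ => z ^ (ν : ℂ)) (ν * z ^ ((ν : ℂ) - 1)) z := by
    simpa using (hasDerivAt_id z).cpow_const (c := (ν : ℂ)) hz
  have hcomp : HasDerivAt (fun z : ℂ => F (z ^ 2)) (deriv F (z ^ 2) * (2 * z)) z :=
    (HasDerivAt.comp z (hF (z ^ 2)).hasDerivAt (hasDerivAt_pow 2 z)).congr_deriv (by simp)
  have hderiv := ((hpow.mul hcomp).const_mul K).congr_of_eventuallyEq
    (eventually_of_mem (Complex.isOpen_slitPlane.mem_nhds hz) hf)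
  refine ⟨hderiv.differentiableAt, ?_⟩
  rw [hderiv.deriv, eulerShift, Complex.cpow_sub _ _ hz0, Complex.cpow_one]
  field_simp

lemma besselN_eq_iterate_mul_deriv (hJ : DifferentiableAt ℂ (deriv (besselJ ν)) z) :
    besselN a b c ν z = a * (z * deriv (fun z => z * deriv (besselJ ν) z) z) +
      (b - a) * (z * deriv (besselJ ν) z) + c * besselJ ν z := by
  have hderiv : deriv (fun z => z * deriv (besselJ ν) z) z =
      deriv (besselJ ν) z + z * deriv (deriv (besselJ ν)) z :=
    (((hasDerivAt_id z).mul hJ.hasDerivAt).congr_deriv (by simp)).deriv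
  rw [besselN, hderiv]
  ring

lemma two_rpow_mul_Gamma_pos (hν : -1 < ν) : 0 < 2 ^ ν * Real.Gamma (ν + 1) :=
  mul_pos (Real.rpow_pos_of_pos two_pos ν) (Real.Gamma_pos_of_pos (by linarith))

theorem normConst_mul_besselN (hν : -1 < ν) (hz : z ∈ Complex.slitPlane) :
    (normConst a b c ν : ℂ) * besselN a b c ν z =
      z ^ (ν : ℂ) * besselNSeries a b c ν (z ^ 2) := by
  have hF := hasEntireSeries_besselSeries (x := ν + 1) (by linarith)
  have hJ : ∀ z ∈ Complex.slitPlane, besselJ ν z = _ :=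
    fun z hz => besselJ_eq hν (Complex.slitPlane_ne_zero hz)
  have hθJ : ∀ z ∈ Complex.slitPlane, z * deriv (besselJ ν) z = _ :=
    fun z hz => (mul_deriv_of_eqOn_cpow_mul_comp_sq hF.differentiable hJ hz).2
  have hθθJ := (mul_deriv_of_eqOn_cpow_mul_comp_sq (hF.eulerShift ν).differentiable hθJ hz).2
  have hdiff : DifferentiableOn ℂ (besselJ ν) Complex.slitPlane := fun z hz =>
    (mul_deriv_of_eqOn_cpow_mul_comp_sq hF.differentiable hJ hz).1.differentiableWithinAt
  have hpos : ((2 ^ ν * Real.Gamma (ν + 1) : ℝ) : ℂ) ≠ 0 :=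
    Complex.ofReal_ne_zero.2 (two_rpow_mul_Gamma_pos hν).ne'
  rw [besselN_eq_iterate_mul_deriv ((hdiff.deriv Complex.isOpen_slitPlane).differentiableAt
    (Complex.isOpen_slitPlane.mem_nhds hz)), hθθJ, hθJ z hz, hJ z hz, normConst, besselNSeries,
    Complex.ofReal_div]
  field_simp

lemma normConst_ne_zero (hν : -1 < ν) (hQ : quadQ a b c ν ≠ 0) :
    (normConst a b c ν : ℂ) ≠ 0 :=
  Complex.ofReal_ne_zero.2 (div_ne_zero (two_rpow_mul_Gamma_pos hν).ne' hQ)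

lemma differentiable_besselNSeries (hν : -1 < ν) : Differentiable ℂ (besselNSeries a b c ν) :=
  (hasEntireSeries_besselNSeries a b c hν).differentiable

lemma besselNSeries_ofReal_ne_zero (hν : -1 < ν) (hQ : quadQ a b c ν ≠ 0)
    (hW₀ : besselNSeries a b c ν 0 = 1)
    (hzero : ∀ x : ℝ, 0 < x → besselN a b c ν x = 0 → 1 < x) :
    ∀ t ∈ Icc (0 : ℝ) 1, besselNSeries a b c ν t ≠ 0 := by
  rintro t ⟨ht₀, ht₁⟩ hW
  have ht : 0 < t := ht₀.lt_of_ne' fun h => by simp [h, hW₀] at hW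
  have hN := normConst_mul_besselN (a := a) (b := b) (c := c) hν
    (Complex.ofReal_mem_slitPlane.2 (Real.sqrt_pos.2 ht))
  rw [← Complex.ofReal_pow, Real.sq_sqrt ht₀, hW, mul_zero, mul_eq_zero] at hN
  exact (hzero _ (Real.sqrt_pos.2 ht) (hN.resolve_left (normConst_ne_zero hν hQ))).not_ge
    (Real.sqrt_le_one.2 ht₁)

lemma logDeriv_besselN_one (hν : -1 < ν) (hQ : quadQ a b c ν ≠ 0)
    (hW : besselNSeries a b c ν 1 ≠ 0) :
    logDeriv (besselN a b c ν) 1 = ν + 2 * logDeriv (besselNSeries a b c ν) 1 := by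
  have hn := normConst_ne_zero hν hQ
  have hN : ∀ z ∈ Complex.slitPlane, besselN a b c ν z =
      (normConst a b c ν : ℂ)⁻¹ * (z ^ (ν : ℂ) * besselNSeries a b c ν (z ^ 2)) := fun z hz => by
    rw [← normConst_mul_besselN hν hz, inv_mul_cancel_left₀ hn]
  have hderiv := (mul_deriv_of_eqOn_cpow_mul_comp_sq (differentiable_besselNSeries hν) hN
    Complex.one_mem_slitPlane).2
  simp only [one_mul, Complex.one_cpow, one_pow, eulerShift] at hderiv
  rw [logDeriv_apply, logDeriv_apply, hderiv, hN 1 Complex.one_mem_slitPlane]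
  simp only [one_mul, Complex.one_cpow, one_pow]
  field_simp

end BesselFunctions

section SlitPlane

lemma dense_slitPlane : Dense Complex.slitPlane :=
  ((dense_compl_singleton (0 : ℝ)).preimage Complex.isOpenMap_im).mono fun _ h => Or.inr h

lemma extendFrom_slitPlane_eq {X : Type*} [TopologicalSpace X] [T2Space X] {f G : ℂ → X}
    (hG : Continuous G) (h : EqOn f G Complex.slitPlane) :
    extendFrom Complex.slitPlane f = G :=
  funext fun z => extendFrom_eq (dense_slitPlane z)
    (hG.continuousWithinAt.tendsto.congr' h.symm.eventuallyEq_nhdsWithin)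

lemma cpow_half_mem_slitPlane {z : ℂ} (hz : z ∈ Complex.slitPlane) :
    z ^ (1 / 2 : ℂ) ∈ Complex.slitPlane := by
  have hre : 0 < ‖z‖ + z.re := by
    rcases hz with hz | hz
    · positivity
    · linarith [neg_abs_le z.re, Complex.abs_re_lt_norm.2 hz]
  rw [Complex.mem_slitPlane_iff, one_div, Complex.cpow_inv_two_re]
  exact Or.inl (by positivity)

lemma cpow_half_cpow (z s : ℂ) : (z ^ (1 / 2 : ℂ)) ^ s = z ^ (s / 2) := by
  have him : (Complex.log z * (1 / 2)).im = z.arg / 2 := by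
    rw [mul_one_div, Complex.div_ofNat_im, Complex.log_im]
  rw [← Complex.cpow_mul, one_div_mul_eq_div] <;> rw [him]
  · linarith [Complex.neg_pi_lt_arg z, Real.pi_pos]
  · linarith [Complex.arg_le_pi z, Real.pi_pos]

variable {a b c ν : ℝ}

lemma normalizedG_eq (hν : -1 < ν) :
    normalizedG a b c ν = fun z => z * besselNSeries a b c ν (z ^ 2) := by
  refine extendFrom_slitPlane_eq
    (continuous_id.mul ((differentiable_besselNSeries hν).continuous.comp (continuous_pow 2)))
    fun z hz => ?_
  have hz0 := Complex.slitPlane_ne_zero hz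
  have hpow : z ^ (ν : ℂ) ≠ 0 := by simp [Complex.cpow_eq_zero_iff, hz0]
  simp only [Complex.cpow_sub _ _ hz0, Complex.cpow_one]
  field_simp
  exact normConst_mul_besselN hν hz

lemma normalizedH_eq (hν : -1 < ν) :
    normalizedH a b c ν = fun z => z * besselNSeries a b c ν z := by
  refine extendFrom_slitPlane_eq
    (continuous_id.mul (differentiable_besselNSeries hν).continuous) fun z hz => ?_
  have hz0 := Complex.slitPlane_ne_zero hz
  have hpow : z ^ ((ν : ℂ) / 2) ≠ 0 := by simp [Complex.cpow_eq_zero_iff, hz0]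
  have hsq : (z ^ (1 / 2 : ℂ)) ^ 2 = z := by rw [one_div, Complex.cpow_ofNat_inv_pow]
  have hN := normConst_mul_besselN (a := a) (b := b) (c := c) hν (cpow_half_mem_slitPlane hz)
  rw [cpow_half_cpow, hsq] at hN
  simp only [Complex.cpow_sub _ _ hz0, Complex.cpow_one]
  field_simp
  exact hN

lemma isNormalizedF_iff (hν : -1 < ν) {F : ℂ → ℂ} :
    IsNormalizedF a b c ν F ↔ ∃ L : ℂ → ℂ, DifferentiableOn ℂ L (Metric.ball 0 1) ∧ L 0 = 0 ∧
      EqOn (fun z => Complex.exp (L z)) (fun z => besselNSeries a b c ν (z ^ 2))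
        (Metric.ball 0 1) ∧
      ∀ z ∈ Metric.ball (0 : ℂ) 1, F z = z * Complex.exp (L z / ν) := by
  refine exists_congr fun L => and_congr_right fun hL => and_congr_right fun _ =>
    and_congr_left fun _ => ⟨fun h => ?_, fun h z hz => ?_⟩
  · have heq : EqOn (fun z => Complex.exp (L z)) (fun z => besselNSeries a b c ν (z ^ 2))
        (Metric.ball (0 : ℂ) 1 ∩ Complex.slitPlane) := fun z hz => by
      have hpow : z ^ (ν : ℂ) ≠ 0 := by
        simp [Complex.cpow_eq_zero_iff, Complex.slitPlane_ne_zero hz.2]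
      exact mul_left_cancel₀ hpow ((h z hz).symm.trans (normConst_mul_besselN hν hz.2))
    exact heq.of_subset_closure hL.continuousOn.cexp
      ((differentiable_besselNSeries hν).continuous.comp (continuous_pow 2)).continuousOn
      inter_subset_left (dense_slitPlane.open_subset_closure_inter Metric.isOpen_ball)
  · exact (normConst_mul_besselN hν hz.2).trans (congrArg _ (h hz.1).symm)

end SlitPlane

section HolomorphicInverse

variable {U : Set ℂ} {φ ψ : ℂ → ℂ} {z : ℂ}

lemma not_eventually_eq_const_of_injOn {α : Type*} {f : ℂ → α} (hU : U ∈ 𝓝 z)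
    (hinj : InjOn f U) : ¬ ∀ᶠ w in 𝓝 z, f w = f z := by
  intro h
  have hz : ∀ᶠ w in 𝓝 z, w = z :=
    (h.and hU).mono fun w hw => hinj hw.2 (mem_of_mem_nhds hU) hw.1
  obtain ⟨w, hw, hne⟩ := (hz.filter_mono nhdsWithin_le_nhds |>.and
    (self_mem_nhdsWithin : ∀ᶠ w in 𝓝[≠] z, w ≠ z)).exists
  exact hne hw

lemma map_nhds_eq_of_injOn (hφ : AnalyticAt ℂ φ z) (hU : U ∈ 𝓝 z) (hinj : InjOn φ U) :
    map φ (𝓝 z) = 𝓝 (φ z) :=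
  hφ.continuousAt.tendsto.antisymm <|
    hφ.eventually_constant_or_nhds_le_map_nhds.resolve_left
      (not_eventually_eq_const_of_injOn hU hinj)

lemma eventually_deriv_ne_zero_of_injOn (hφ : AnalyticAt ℂ φ z) (hU : U ∈ 𝓝 z)
    (hinj : InjOn φ U) : ∀ᶠ w in 𝓝[≠] z, deriv φ w ≠ 0 := by
  refine hφ.deriv.eventually_eq_zero_or_eventually_ne_zero.resolve_left fun h => ?_
  have htop := hφ.analyticOrderAt_deriv_add_one
  rw [analyticOrderAt_eq_top.2 h, top_add, eq_comm, analyticOrderAt_eq_top] at htop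
  exact not_eventually_eq_const_of_injOn hU hinj (htop.mono fun w hw => sub_eq_zero.1 hw)

lemma differentiableOn_image_of_leftInvOn (hU : IsOpen U) (hφ : DifferentiableOn ℂ φ U)
    (hψ : LeftInvOn ψ φ U) : DifferentiableOn ℂ ψ (φ '' U) := by
  have han {z : ℂ} (hz : z ∈ U) : AnalyticAt ℂ φ z := hφ.analyticOnNhd hU z hz
  have hmap {z : ℂ} (hz : z ∈ U) : map φ (𝓝 z) = 𝓝 (φ z) :=
    map_nhds_eq_of_injOn (han hz) (hU.mem_nhds hz) hψ.injOn
  have hcomp {z : ℂ} (hz : z ∈ U) : ψ ∘ φ =ᶠ[𝓝 z] id :=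
    eventually_of_mem (hU.mem_nhds hz) hψ
  have hregular {z : ℂ} (hz : z ∈ U) (hd : deriv φ z ≠ 0) : DifferentiableAt ℂ ψ (φ z) :=
    ((analyticAt_comp_iff_of_deriv_ne_zero (han hz) hd).1
      (analyticAt_id.congr (hcomp hz).symm)).differentiableAt
  rintro _ ⟨z, hz, rfl⟩
  have hcont : ContinuousAt ψ (φ z) := by
    rw [ContinuousAt, ← hmap hz, hψ hz, tendsto_map'_iff]
    exact tendsto_id.congr' (hcomp hz).symm
  have hpunct : ∀ᶠ w in 𝓝[≠] φ z, DifferentiableAt ℂ ψ w := by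
    rw [eventually_nhdsWithin_iff, ← hmap hz, eventually_map]
    filter_upwards [hU.mem_nhds hz, eventually_nhdsWithin_iff.1
      (eventually_deriv_ne_zero_of_injOn (han hz) (hU.mem_nhds hz) hψ.injOn)] with y hy hd hne
    exact hregular hy (hd (ne_of_apply_ne φ hne))
  exact (Complex.analyticAt_of_differentiable_on_punctured_nhds_of_continuousAt hpunct
    hcont).differentiableAt.differentiableWithinAt

end HolomorphicInverse

section Starlike

lemma subordinate_of_mapsTo {φ q : ℂ → ℂ} (hφ : DifferentiableOn ℂ φ (Metric.ball 0 1))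
    (hinj : InjOn φ (Metric.ball 0 1)) (hq : DifferentiableOn ℂ q (Metric.ball 0 1))
    (hq₀ : q 0 = φ 0) (hmaps : MapsTo q (Metric.ball 0 1) (φ '' Metric.ball 0 1)) :
    Subordinate q φ := by
  have hleft := hinj.leftInvOn_invFunOn
  have hright := (surjOn_image φ (Metric.ball (0 : ℂ) 1)).rightInvOn_invFunOn
  refine ⟨hq, Function.invFunOn φ (Metric.ball 0 1) ∘ q,
    (differentiableOn_image_of_leftInvOn Metric.isOpen_ball hφ hleft).comp hq hmaps,
    (surjOn_image φ _).mapsTo_invFunOn.comp hmaps, ?_, fun z hz => (hright (hmaps hz)).symm⟩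
  rw [Function.comp_apply, hq₀, hleft (Metric.mem_ball_self one_pos)]

lemma isMaMindaStarlike_of_norm_mul_logDeriv_lt {φ E f : ℂ → ℂ} {β : ℝ}
    (hφ : DifferentiableOn ℂ φ (Metric.ball 0 1)) (hinj : InjOn φ (Metric.ball 0 1))
    (hφ₀ : φ 0 = 1) (hβ : Metric.ball 1 β ⊆ φ '' Metric.ball 0 1)
    (hE : DifferentiableOn ℂ E (Metric.ball 0 1)) (hE₀ : E 0 = 1)
    (hne : ∀ z ∈ Metric.ball (0 : ℂ) 1, E z ≠ 0)
    (hlog : ∀ z ∈ Metric.ball (0 : ℂ) 1, ‖z * logDeriv E z‖ < β)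
    (hf : ∀ z ∈ Metric.ball (0 : ℂ) 1, f z = z * E z) : IsMaMindaStarlike φ f := by
  have h₀ : (0 : ℂ) ∈ Metric.ball (0 : ℂ) 1 := Metric.mem_ball_self one_pos
  have hder : ∀ z ∈ Metric.ball (0 : ℂ) 1, HasDerivAt f (E z + z * deriv E z) z := by
    intro z hz
    have hnhds := Metric.isOpen_ball.mem_nhds hz
    simpa only [one_mul] using ((hasDerivAt_id' z).mul
      (hE.differentiableAt hnhds).hasDerivAt).congr_of_eventuallyEq (eventually_of_mem hnhds hf)
  have hq : ∀ z ∈ Metric.ball (0 : ℂ) 1, starQuotient f z = 1 + z * logDeriv E z := by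
    intro z hz
    rw [starQuotient]
    split_ifs with h
    · simp [h]
    · have := hne z hz
      rw [(hder z hz).deriv, hf z hz, logDeriv_apply]
      field_simp
  refine ⟨⟨fun z hz => (hder z hz).differentiableAt.differentiableWithinAt, ?_, ?_⟩,
    fun z hz hz₀ => ?_, subordinate_of_mapsTo hφ hinj ?_ ?_ fun z hz => hβ ?_⟩
  · rw [hf 0 h₀, zero_mul]
  · rw [(hder 0 h₀).deriv, hE₀, zero_mul, add_zero]
  · rw [hf z hz]
    exact mul_ne_zero hz₀ (hne z hz)
  · exact ((differentiableOn_id.mul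
      ((hE.deriv Metric.isOpen_ball).div hE hne)).const_add 1).congr hq
  · rw [hq 0 h₀, hφ₀, zero_mul, add_zero]
  · rw [hq z hz, mem_ball_iff_norm, add_sub_cancel_left]
    exact hlog z hz

end Starlike

section Logarithm

lemma logDeriv_cexp_comp {L : ℂ → ℂ} {z : ℂ} (hL : DifferentiableAt ℂ L z) :
    logDeriv (fun w => Complex.exp (L w)) z = deriv L z := by
  rw [logDeriv_apply, hL.hasDerivAt.cexp.deriv, mul_div_cancel_left₀ _ (Complex.exp_ne_zero _)]

lemma exists_eqOn_cexp_comp_of_ne_zero {E : ℂ → ℂ} {x y : ℂ} {r : ℝ}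
    (hE : DifferentiableOn ℂ E (Metric.ball x r)) (hne : ∀ z ∈ Metric.ball x r, E z ≠ 0)
    (hy : Complex.exp y = E x) :
    ∃ L : ℂ → ℂ, DifferentiableOn ℂ L (Metric.ball x r) ∧ L x = y ∧
      EqOn (fun z => Complex.exp (L z)) E (Metric.ball x r) := by
  have hlog : DifferentiableOn ℂ (logDeriv E) (Metric.ball x r) :=
    (hE.deriv Metric.isOpen_ball).div hE hne
  obtain ⟨L, hLx, hL⟩ := hlog.isExactOn_ball.with_val_at x y
  have hLd : DifferentiableOn ℂ L (Metric.ball x r) :=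
    fun z hz => (hL z hz).differentiableAt.differentiableWithinAt
  obtain ⟨k, -, hk⟩ := (logDeriv_eqOn_iff hLd.cexp hE Metric.isOpen_ball
    (convex_ball x r).isPreconnected hne fun z _ => Complex.exp_ne_zero (L z)).1
    fun z hz => (logDeriv_cexp_comp (hL z hz).differentiableAt).trans (hL z hz).deriv
  refine ⟨L, hLd, hLx, fun z hz => ?_⟩
  have hx : x ∈ Metric.ball x r := Metric.mem_ball_self (Metric.pos_of_mem_ball hz)
  have hk₁ : k = 1 := by simpa [hLx, hy, hne x hx] using hk hx
  simpa [hk₁] using hk hz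

lemma logDeriv_cexp_div {E L : ℂ → ℂ} {z : ℂ} (hL : DifferentiableAt ℂ L z)
    (h : (fun w => Complex.exp (L w)) =ᶠ[𝓝 z] E) (k : ℂ) :
    logDeriv (fun w => Complex.exp (L w / k)) z = logDeriv E z / k := by
  rw [logDeriv_cexp_comp (hL.div_const k), deriv_div_const, ← logDeriv_cexp_comp hL,
    logDeriv_apply, logDeriv_apply, h.deriv_eq, h.eq_of_nhds]

end Logarithm

namespace PosRootedLimit

variable {W : ℂ → ℂ} {R : ℝ}

lemma norm_mul_logDeriv_le (hW : PosRootedLimit W) (hR : ∀ t ∈ Icc 0 R, W (t : ℂ) ≠ 0) {w : ℂ}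
    (hw : ‖w‖ ≤ R) : ‖w * logDeriv W w‖ ≤ R * -(logDeriv W R).re := by
  rw [norm_mul]
  exact mul_le_mul hw (hW.norm_logDeriv_le hR hw) (norm_nonneg _) ((norm_nonneg w).trans hw)

lemma norm_mul_logDeriv_comp_sq_le (hW : PosRootedLimit W)
    (hR : ∀ t ∈ Icc 0 R, W (t : ℂ) ≠ 0) {z : ℂ} (hz : ‖z ^ 2‖ ≤ R) :
    ‖z * logDeriv (fun w => W (w ^ 2)) z‖ ≤ 2 * (R * -(logDeriv W R).re) := by
  have hchain : z * logDeriv (fun w => W (w ^ 2)) z = 2 * (z ^ 2 * logDeriv W (z ^ 2)) := by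
    have hsq : HasDerivAt (fun w : ℂ => w ^ 2) (2 * z) z := by simpa using hasDerivAt_pow 2 z
    have hcomp : logDeriv (fun w => W (w ^ 2)) z = logDeriv W (z ^ 2) * (2 * z) :=
      (logDeriv_comp (g := fun w => w ^ 2) (hW.differentiable _) hsq.differentiableAt).trans
        (by rw [hsq.deriv])
    rw [hcomp]
    ring
  rw [hchain, norm_mul, Complex.norm_ofNat]
  gcongr
  exact hW.norm_mul_logDeriv_le hR hz

end PosRootedLimit

section LaguerrePolyaStarlike

lemma norm_sq_le_one_of_mem_ball {z : ℂ} (hz : z ∈ Metric.ball (0 : ℂ) 1) : ‖z ^ 2‖ ≤ 1 := by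
  rw [norm_pow]
  exact pow_le_one₀ (norm_nonneg z) (mem_ball_zero_iff.1 hz).le

namespace PosRootedLimit

variable {φ W : ℂ → ℂ} {β : ℝ}

lemma isMaMindaStarlike_mul (hW : PosRootedLimit W) (hne : ∀ t ∈ Icc (0 : ℝ) 1, W t ≠ 0)
    (hφ : DifferentiableOn ℂ φ (Metric.ball 0 1)) (hinj : InjOn φ (Metric.ball 0 1))
    (hφ₀ : φ 0 = 1) (hβ : Metric.ball 1 β ⊆ φ '' Metric.ball 0 1)
    (h : -(logDeriv W 1).re < β) : IsMaMindaStarlike φ fun z => z * W z := by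
  refine isMaMindaStarlike_of_norm_mul_logDeriv_lt hφ hinj hφ₀ hβ
    hW.differentiable.differentiableOn hW.map_zero
    (fun z hz => hW.map_ne_zero hne (mem_ball_zero_iff.1 hz).le) (fun z hz => ?_) fun _ _ => rfl
  have hbound := hW.norm_mul_logDeriv_le hne (mem_ball_zero_iff.1 hz).le
  rw [Complex.ofReal_one, one_mul] at hbound
  exact hbound.trans_lt h

lemma isMaMindaStarlike_mul_comp_sq (hW : PosRootedLimit W)
    (hne : ∀ t ∈ Icc (0 : ℝ) 1, W t ≠ 0)
    (hφ : DifferentiableOn ℂ φ (Metric.ball 0 1)) (hinj : InjOn φ (Metric.ball 0 1))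
    (hφ₀ : φ 0 = 1) (hβ : Metric.ball 1 β ⊆ φ '' Metric.ball 0 1)
    (h : 2 * -(logDeriv W 1).re < β) : IsMaMindaStarlike φ fun z => z * W (z ^ 2) := by
  refine isMaMindaStarlike_of_norm_mul_logDeriv_lt (E := fun z => W (z ^ 2)) hφ hinj hφ₀ hβ
    (hW.differentiable.comp (differentiable_pow 2)).differentiableOn
    (by rw [zero_pow two_ne_zero, hW.map_zero])
    (fun z hz => hW.map_ne_zero hne (norm_sq_le_one_of_mem_ball hz)) (fun z hz => ?_)
    fun _ _ => rfl
  have hbound := hW.norm_mul_logDeriv_comp_sq_le hne (norm_sq_le_one_of_mem_ball hz)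
  rw [Complex.ofReal_one, one_mul] at hbound
  exact hbound.trans_lt h

lemma isMaMindaStarlike_mul_cexp_div (hW : PosRootedLimit W)
    (hne : ∀ t ∈ Icc (0 : ℝ) 1, W t ≠ 0)
    (hφ : DifferentiableOn ℂ φ (Metric.ball 0 1)) (hinj : InjOn φ (Metric.ball 0 1))
    (hφ₀ : φ 0 = 1) (hβ : Metric.ball 1 β ⊆ φ '' Metric.ball 0 1) {ν : ℝ} (hν : 0 < ν)
    (h : 2 * -(logDeriv W 1).re / ν < β) {L F : ℂ → ℂ}
    (hL : DifferentiableOn ℂ L (Metric.ball 0 1)) (hL₀ : L 0 = 0)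
    (hexp : EqOn (fun z => Complex.exp (L z)) (fun z => W (z ^ 2)) (Metric.ball 0 1))
    (hF : ∀ z ∈ Metric.ball (0 : ℂ) 1, F z = z * Complex.exp (L z / ν)) :
    IsMaMindaStarlike φ F := by
  refine isMaMindaStarlike_of_norm_mul_logDeriv_lt hφ hinj hφ₀ hβ (hL.div_const _).cexp
    (by rw [hL₀, zero_div, Complex.exp_zero]) (fun _ _ => Complex.exp_ne_zero _)
    (fun z hz => ?_) hF
  have hnhds := Metric.isOpen_ball.mem_nhds hz
  have hbound := hW.norm_mul_logDeriv_comp_sq_le hne (norm_sq_le_one_of_mem_ball hz)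
  rw [Complex.ofReal_one, one_mul] at hbound
  rw [logDeriv_cexp_div (hL.differentiableAt hnhds) (eventually_of_mem hnhds hexp),
    mul_div_assoc', norm_div, Complex.norm_of_nonneg hν.le]
  exact (div_le_div_of_nonneg_right hbound hν.le).trans_lt h

lemma exists_cexp_eq_comp_sq (hW : PosRootedLimit W) (hne : ∀ t ∈ Icc (0 : ℝ) 1, W t ≠ 0) :
    ∃ L : ℂ → ℂ, DifferentiableOn ℂ L (Metric.ball 0 1) ∧ L 0 = 0 ∧
      EqOn (fun z => Complex.exp (L z)) (fun z => W (z ^ 2)) (Metric.ball 0 1) :=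
  exists_eqOn_cexp_comp_of_ne_zero
    (hW.differentiable.comp (differentiable_pow 2)).differentiableOn
    (fun _ hz => hW.map_ne_zero hne (norm_sq_le_one_of_mem_ball hz))
    (by simp [hW.map_zero])

end PosRootedLimit

end LaguerrePolyaStarlike

section BesselStarlike

lemma nonneg_discrim_or_nonneg_mul_sub {a b c : ℝ} (h : (c = 0 ∧ a ≠ b) ∨ (0 < c ∧ a < b)) :
    0 ≤ (b - a) ^ 2 - 4 * a * c ∨ 0 ≤ a * (b - a) := by
  rcases h with ⟨rfl, -⟩ | ⟨hc, hab⟩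
  · exact Or.inl (by simp only [mul_zero, sub_zero, sq_nonneg])
  · rcases le_or_gt 0 a with ha | ha
    · exact Or.inr (mul_nonneg ha (sub_nonneg.2 hab.le))
    · exact Or.inl (by nlinarith [sq_nonneg (b - a), mul_neg_of_neg_of_pos ha hc])

theorem mainTheorem5_general (a b c ν β : ℝ) (φ : ℂ → ℂ)
    (habc : 0 ≤ (b - a) ^ 2 - 4 * a * c ∨ 0 ≤ a * (b - a))
    (hν : -1 < ν) (hν₀ : ∀ x : ℝ, quadQ a b c x = 0 → x ≤ ν) (hQ : quadQ a b c ν ≠ 0)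
    (hzero : ∀ x : ℝ, 0 < x → besselN a b c ν (x : ℂ) = 0 → 1 < x)
    (hφ : DifferentiableOn ℂ φ (Metric.ball 0 1)) (hinj : InjOn φ (Metric.ball 0 1))
    (hφ₀ : φ 0 = 1) (hβ : Metric.ball 1 β ⊆ φ '' Metric.ball 0 1) :
    (0 < ν →
      1 - 1 / ν * (deriv (besselN a b c ν) 1 / besselN a b c ν 1).re < β →
        (∃ F : ℂ → ℂ, IsNormalizedF a b c ν F) ∧
          ∀ F : ℂ → ℂ, IsNormalizedF a b c ν F → IsMaMindaStarlike φ F) ∧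
    (ν - (deriv (besselN a b c ν) 1 / besselN a b c ν 1).re < β →
      IsMaMindaStarlike φ (normalizedG a b c ν)) ∧
    (ν / 2 - (deriv (besselN a b c ν) 1 / (2 * besselN a b c ν 1)).re < β →
      IsMaMindaStarlike φ (normalizedH a b c ν)) := by
  have hW := posRootedLimit_besselNSeries habc hν hν₀ hQ
  have hne := besselNSeries_ofReal_ne_zero hν hQ hW.map_zero hzero
  have hlog : (deriv (besselN a b c ν) 1 / besselN a b c ν 1).re =
      ν + 2 * (logDeriv (besselNSeries a b c ν) 1).re := by
    have h₁ : besselNSeries a b c ν 1 ≠ 0 := by simpa using hne 1 (right_mem_Icc.2 zero_le_one)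
    rw [← logDeriv_apply, logDeriv_besselN_one hν hQ h₁]
    simp
  simp only [isNormalizedF_iff hν, normalizedG_eq hν, normalizedH_eq hν]
  refine ⟨fun hpos h => ⟨?_, ?_⟩, fun h => ?_, fun h => ?_⟩
  · obtain ⟨L, hL, hL₀, hexp⟩ := hW.exists_cexp_eq_comp_sq hne
    exact ⟨_, L, hL, hL₀, hexp, fun _ _ => rfl⟩
  · rintro F ⟨L, hL, hL₀, hexp, hF⟩
    refine hW.isMaMindaStarlike_mul_cexp_div hne hφ hinj hφ₀ hβ hpos ?_ hL hL₀ hexp hF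
    convert h using 1
    rw [hlog]
    field_simp
    ring
  · exact hW.isMaMindaStarlike_mul_comp_sq hne hφ hinj hφ₀ hβ (by rw [hlog] at h; linarith)
  · rw [mul_comm, ← div_div, Complex.div_ofNat_re, hlog] at h
    exact hW.isMaMindaStarlike_mul hne hφ hinj hφ₀ hβ (by linarith)

end BesselStarlike

theorem mainTheorem5 (a b c ν β : ℝ) (φ : ℂ → ℂ)
    (habc : (c = 0 ∧ a ≠ b) ∨ (0 < c ∧ a < b))
    -- `ν ≥ max {0, ν₀}`, with `Q(ν) ≠ 0`
    (hν : 0 ≤ ν) (hν₀ : ∀ x : ℝ, quadQ a b c x = 0 → x ≤ ν) (hQ : quadQ a b c ν ≠ 0)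
    -- the smallest positive zero of `N_ν` is larger than `1`
    (hzero : ∀ x : ℝ, 0 < x → besselN a b c ν (x : ℂ) = 0 → 1 < x)
    (hφ : IsMaMinda φ)
    -- `φ(-1) = 1 - β`, as a radial limit
    (hφβ : Tendsto (fun t : ℝ => φ (t : ℂ)) (𝓝[>] (-1 : ℝ)) (𝓝 ((1 - β : ℝ) : ℂ)))
    (hβ : IsGreatest {r : ℝ | Metric.ball (1 : ℂ) r ⊆ φ '' Metric.ball 0 1} β) :
    (ν ≠ 0 →
      1 - 1 / ν * (deriv (besselN a b c ν) 1 / besselN a b c ν 1).re < β →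
        (∃ F : ℂ → ℂ, IsNormalizedF a b c ν F) ∧
          ∀ F : ℂ → ℂ, IsNormalizedF a b c ν F → IsMaMindaStarlike φ F) ∧
    (ν - (deriv (besselN a b c ν) 1 / besselN a b c ν 1).re < β →
      IsMaMindaStarlike φ (normalizedG a b c ν)) ∧
    (ν / 2 - (deriv (besselN a b c ν) 1 / (2 * besselN a b c ν 1)).re < β →
      IsMaMindaStarlike φ (normalizedH a b c ν)) :=
  let ⟨hf, hg, hh⟩ := mainTheorem5_general a b c ν β φ (nonneg_discrim_or_nonneg_mul_sub habc)
    (by linarith) hν₀ hQ hzero hφ.holomorphic hφ.univalent hφ.map_zero hβ.1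
  ⟨fun hne => hf (hν.lt_of_ne' hne), hg, hh⟩
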